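/- Let $d_1,\dots,d_l$ be block lengths, $N=d_1+\cdots+d_l$, and write $x\in\mathbb{R}^N$ as the concatenation of its consecutive blocks $x[i]\in\mathbb{R}^{d_i}$, $1\le i\le l$. Put $\|x\|_{2,\mathcal I}=\sum_{i=1}^{l}\|x[i]\|_2$, and call $x$ block $k$-sparse if $x[i]\neq 0$ for at most $k$ indices $i$. For $\Phi\in\mathbb{R}^{M\times N}$ and an integer $k\ge 0$, let $\delta_{k|\mathcal I}$ be the smallest $\delta\ge 0$ such that $$(1-\delta)\|x\|_2^2\le\|\Phi x\|_2^2\le(1+\delta)\|x\|_2^2\quad\text{for all block } k\text{-sparse } x\in\mathbb{R}^N;$$ for real $r\ge 0$ put $\delta_{r|\mathcal I}=\delta_{\lceil r\rceil|\mathcal I}$. Corollary 1.1. Let $M<N$, $\Phi\in\mathbb{R}^{M\times N}$, let $s$ be a natural number and $t$ a real number with $0<t<4/3$ and $ts\ge 2$, and suppose that $$\delta_{ts|\mathcal I}<\frac{t}{4-t}.$$ Let $x\in\mathbb{R}^N$ be block $s$-sparse and $b=\Phi x$. Then $x$ is the unique solution of the $l_2/l_1$ program $$\min_{z\in\mathbb{R}^N}\|z\|_{2,\mathcal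 I}\quad\text{subject to}\quad \Phi z=b.$$ -/

import Mathlib

noncomputable section

namespace BlockCS

/-- The `i`-th block `x[i] ∈ ℝ^{d_i}` of `x ∈ ℝ^N`, `N = d_1 + ⋯ + d_l`, the blocks being
consecutive: `finSigmaFinEquiv ⟨i, j⟩` is the position `d_0 + ⋯ + d_{i-1} + j` (counting from 0). -/
def block {l : ℕ} (d : Fin l → ℕ) (x : EuclideanSpace ℝ (Fin (∑ i, d i))) (i : Fin l) :
    EuclideanSpace ℝ (Fin (d i)) :=
  WithLp.toLp 2 fun j => x (finSigmaFinEquiv ⟨i, j⟩)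

/-- `‖x‖_{2,0}`: the number of blocks with `‖x[i]‖₂ > 0`. -/
def blockNorm0 {l : ℕ} (d : Fin l → ℕ) (x : EuclideanSpace ℝ (Fin (∑ i, d i))) : ℕ :=
  (Finset.univ.filter fun i => 0 < ‖block d x i‖).card

/-- `x` is block `k`-sparse. -/
def IsBlockSparse {l : ℕ} (d : Fin l → ℕ) (k : ℕ) (x : EuclideanSpace ℝ (Fin (∑ i, d i))) : Prop :=
  blockNorm0 d x ≤ k

/-- `‖x‖_{2,I} = ∑ i, ‖x[i]‖₂`. -/
def blockNorm1 {l : ℕ} (d : Fin l → ℕ) (x : EuclideanSpace ℝ (Fin (∑ i, d i))) : ℝ :=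
  ∑ i, ‖block d x i‖

/-- The constants `δ ≥ 0` for which `1 - δ ≤ ‖Φ x‖₂² / ‖x‖₂² ≤ 1 + δ` for all nonzero
block `k`-sparse `x` (denominators cleared). -/
def blockRIPConstants {l M : ℕ} (d : Fin l → ℕ) (Φ : Matrix (Fin M) (Fin (∑ i, d i)) ℝ)
    (k : ℕ) : Set ℝ :=
  {δ | 0 ≤ δ ∧ ∀ x : EuclideanSpace ℝ (Fin (∑ i, d i)), IsBlockSparse d k x →
    (1 - δ) * ‖x‖ ^ 2 ≤ ‖Matrix.toEuclideanLin Φ x‖ ^ 2 ∧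
      ‖Matrix.toEuclideanLin Φ x‖ ^ 2 ≤ (1 + δ) * ‖x‖ ^ 2}

/-- The block restricted isometry constant `δ_{k|I}` of `Φ`: the smallest admissible constant
(the minimum is attained, see `isLeast_blockRIC`). -/
def blockRIC {l M : ℕ} (d : Fin l → ℕ) (Φ : Matrix (Fin M) (Fin (∑ i, d i)) ℝ) (k : ℕ) : ℝ :=
  sInf (blockRIPConstants d Φ k)

/-- The infimum defining the block restricted isometry constant is a minimum. -/
theorem isLeast_blockRIC {l M : ℕ} (d : Fin l → ℕ) (Φ : Matrix (Fin M) (Fin (∑ i, d i)) ℝ)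
    (k : ℕ) : IsLeast (blockRIPConstants d Φ k) (blockRIC d Φ k) := by
  have hbdd : BddBelow (blockRIPConstants d Φ k) := ⟨0, fun δ hδ => hδ.1⟩
  have hne : (blockRIPConstants d Φ k).Nonempty := by
    set L := LinearMap.toContinuousLinearMap (Matrix.toEuclideanLin Φ) with hL
    refine ⟨1 + ‖L‖ ^ 2, by positivity, fun x _ => ?_⟩
    have h : ‖Matrix.toEuclideanLin Φ x‖ ≤ ‖L‖ * ‖x‖ := L.le_opNorm x
    have h2 : ‖Matrix.toEuclideanLin Φ x‖ ^ 2 ≤ (‖L‖ * ‖x‖) ^ 2 := by gcongr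
    constructor
    · nlinarith [sq_nonneg (‖L‖ * ‖x‖), sq_nonneg ‖Matrix.toEuclideanLin Φ x‖]
    · nlinarith [sq_nonneg ‖x‖]
  have hcl : IsClosed (blockRIPConstants d Φ k) := by
    simp only [blockRIPConstants, Set.ofPred_and, Set.ofPred_forall]
    refine isClosed_Ici.inter (isClosed_iInter fun x => isClosed_iInter fun _ => ?_)
    exact (isClosed_le (by fun_prop) (by fun_prop)).inter (isClosed_le (by fun_prop) (by fun_prop))
  exact ⟨hcl.csInf_mem hne hbdd, fun δ hδ => csInf_le hbdd hδ⟩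

/-- The set of solutions of the `l2/l1` program: minimize `‖z‖_{2,I}` subject to `b = Φ z`. -/
def l2l1Solutions {l M : ℕ} (d : Fin l → ℕ) (Φ : Matrix (Fin M) (Fin (∑ i, d i)) ℝ)
    (b : EuclideanSpace ℝ (Fin M)) : Set (EuclideanSpace ℝ (Fin (∑ i, d i))) :=
  {z | b = Matrix.toEuclideanLin Φ z ∧
    ∀ y, b = Matrix.toEuclideanLin Φ y → blockNorm1 d z ≤ blockNorm1 d y}

end BlockCS

end

/-! ### Scalar inequality behind the threshold `k / (4 s - k)`. -/

noncomputable section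

namespace BlockCS

/-! It suffices to prove a null space property: a kernel vector of `Φ` whose blocks on some `s`
indices have at least the `l2/l1` mass of the remaining blocks is zero. A competitor `z` with
`‖z‖_{2,I} ≤ ‖x‖_{2,I}` yields such a vector `z - x`. Only the block norms `a i` and the images `w
i` of the normalized blocks matter, so blocks become scalar coefficients with `∑ a i • w i = 0`.

Let `T` hold the `s` largest `a i`, `X = ∑_{T} a i ^ 2`, `P = ‖∑_{T} a i • w i‖ ^ 2`, and `k = ⌈t s⌉
= m + b`. The tail is a convex combination of `b`-sparse vectors `u` of controlled energy
(`mem_convexHull_sparse_box`, `exists_sparse_mean`). Applying the isometry bounds to `x_S - (m / s)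
u` and `x_S + (b / s) u`, and averaging over the `m`-subsets `S` of `T` and over `u`, turns the
cross terms into multiples of `P`, because the images of the `u` average to minus that of the head.
Weights `b ^ 2` and `m ^ 2` cancel the energies of the images of the `u`, which gives
`IsRIPOn.head_le`.

For `3 k < 4 s`, a nearly equal split used in both orders bounds `P` from above; subset averages or
the split `(s, k - s)` bound it from below. These contradict `δ < k / (4 s - k)`. Rounding may
produce `4 s ≤ 3 k`; then the split `(s, k - s)` and `δ < 1 / 2` suffice. -/

/-- Here `a` and `b` are the two parts of `k`, and `P`, `X` are the squared norms of the head's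
image and of the head. Eliminating `P` between `hup` and either alternative of `hlow` leaves a
positive multiple of `k - δ (4 s - k)`, which would have to be nonpositive. -/
theorem ric_scalar_contradiction {P X δ s k a b : ℝ} (ha : 1 ≤ a) (hb : 1 ≤ b)
    (hab : (a - b) ^ 2 ≤ 1)
    (hk : k = a + b) (hks : 3 * k < 4 * s) (hX : 0 < X) (hδ : δ * (4 * s - k) < k)
    (hup : (-(a - b) ^ 2 + 2 * a * b * (2 * s - k) / s) * P ≤
      (-(a - b) ^ 2 + δ * k * (2 * s - k)) * X)
    (hlow : k * P ≥ (k - δ * (2 * s - k)) * X ∨ (4 * s - 3 * k) * P ≥ (2 * s - k - δ * k) * X) :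
    False := by
  have hs : 0 < s := by linarith
  have hk0 : 2 ≤ k := by linarith
  have hab1 : 1 ≤ a * b := by nlinarith
  have hr : 2 / 3 ≤ (2 * s - k) / s := by rw [le_div_iff₀ hs]; linarith
  have e1 : 2 * a * b * (2 * s - k) / s = 2 * (a * b) * ((2 * s - k) / s) := by ring
  -- The second term is at least `4 / 3`, while `(a - b) ^ 2 ≤ 1`; this is where the near-equality
  -- of the split is needed.
  have hκ : 0 ≤ -(a - b) ^ 2 + 2 * a * b * (2 * s - k) / s := by
    rw [e1]; nlinarith
  have hpos : 0 < 2 * a * b * (2 * s - k) / s := by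
    rw [e1]; nlinarith
  rcases hlow with h | h
  · have h1 := mul_le_mul_of_nonneg_left h hκ
    have h2 := mul_le_mul_of_nonneg_left hup (by linarith : 0 ≤ k)
    have h3 : 0 < 2 * a * b * (2 * s - k) / s * (k - δ * (4 * s - k)) * X :=
      mul_pos (mul_pos hpos (by linarith)) hX
    have h4 : (-(a - b) ^ 2 + 2 * a * b * (2 * s - k) / s) * ((k - δ * (2 * s - k)) * X)
       - k * ((-(a - b) ^ 2 + δ * k * (2 * s - k)) * X) =
       2 * a * b * (2 * s - k) / s * (k - δ * (4 * s - k)) * X := by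
      subst hk; field_simp; ring
    nlinarith
  · have h1 := mul_le_mul_of_nonneg_left h hκ
    have h2 := mul_le_mul_of_nonneg_left hup (by linarith : 0 ≤ 4 * s - 3 * k)
    have h4 : (-(a - b) ^ 2 + 2 * a * b * (2 * s - k) / s) * ((2 * s - k - δ * k) * X)
       - (4 * s - 3 * k) * ((-(a - b) ^ 2 + δ * k * (2 * s - k)) * X) =
       2 * k * ((s - a) * (s - b)) / s * (k - δ * (4 * s - k)) * X := by
      subst hk; field_simp; ring
    have h5 : 0 < 2 * k * ((s - a) * (s - b)) / s * (k - δ * (4 * s - k)) * X := by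
      have : 0 < s - a := by nlinarith
      have : 0 < s - b := by nlinarith
      have : 0 < k - δ * (4 * s - k) := by linarith
      positivity
    nlinarith

/-! ### Averages over the `m`-element subsets of a finite set. -/

open Finset in
theorem card_filter_mem_powersetCard {ι : Type*} [DecidableEq ι] (T : Finset ι) (m : ℕ) {i : ι}
    (hi : i ∈ T) :
    (#{S ∈ T.powersetCard m | i ∈ S} : ℝ) * #T = m * (#T).choose m := by
  rcases m with _ | m
  · simp
  have h := card_filter_powersetCard_subset {i} T (m + 1) (by simpa using hi) (by simp)
  simp only [singleton_subset_iff, card_singleton, Nat.add_sub_cancel] at h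
  rw [h]
  obtain ⟨n, hn⟩ : ∃ n, #T = n + 1 := ⟨#T - 1, by have := card_pos.2 ⟨i, hi⟩; omega⟩
  rw [hn]
  have := Nat.add_one_mul_choose_eq n m
  rw [Nat.add_sub_cancel]
  norm_cast
  linarith

open Finset in
theorem card_filter_mem_mem_powersetCard {ι : Type*} [DecidableEq ι] (T : Finset ι) (m : ℕ)
    {i j : ι} (hi : i ∈ T) (hj : j ∈ T) (hij : i ≠ j) :
    (#{S ∈ T.powersetCard m | i ∈ S ∧ j ∈ S} : ℝ) * (#T * (#T - 1)) =
      m * (m - 1) * (#T).choose m := by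
  have hp : #({i, j} : Finset ι) = 2 := card_pair hij
  have hsub : ({i, j} : Finset ι) ⊆ T := by
    intro x hx; simp at hx; rcases hx with rfl | rfl <;> assumption
  have heq : {S ∈ T.powersetCard m | i ∈ S ∧ j ∈ S} =
      {S ∈ T.powersetCard m | ({i, j} : Finset ι) ⊆ S} := by
    ext S; simp [insert_subset_iff]
  rw [heq]
  rcases m with _ | _ | m
  · rw [card_eq_zero.2]
    · simp
    · ext S
      simp only [mem_filter, mem_powersetCard, notMem_empty, iff_false]
      rintro ⟨⟨-, h1⟩, h2⟩
      have := card_le_card h2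
      omega
  · rw [card_eq_zero.2]
    · simp
    · ext S
      simp only [mem_filter, mem_powersetCard, notMem_empty, iff_false]
      rintro ⟨⟨-, h1⟩, h2⟩
      have := card_le_card h2
      omega
  have h := card_filter_powersetCard_subset {i, j} T (m + 2) hsub (by omega)
  rw [hp, Nat.add_sub_cancel] at h
  rw [h]
  have := card_le_card hsub
  obtain ⟨n, hn⟩ : ∃ n, #T = n + 2 := ⟨#T - 2, by omega⟩
  rw [hn]
  have h1 := Nat.add_one_mul_choose_eq n m
  have h2 := Nat.add_one_mul_choose_eq (n + 1) (m + 1)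
  rw [Nat.add_sub_cancel]
  have h1' : ((n : ℝ) + 1) * n.choose m = (n + 1).choose (m + 1) * (m + 1) := by exact_mod_cast h1
  have h2' : ((n : ℝ) + 1 + 1) * (n + 1).choose (m + 1) =
      (n + 1 + 1).choose (m + 1 + 1) * (m + 1 + 1) := by exact_mod_cast h2
  push_cast
  have e : ((n + 1 + 1).choose (m + 1 + 1) : ℝ) = (n + 2).choose (m + 2) := rfl
  rw [e] at h2'
  linear_combination ((n : ℝ) + 2) * h1' + ((m : ℝ) + 1) * h2'

open Finset in
theorem sum_powersetCard_sum {ι E : Type*} [DecidableEq ι] [AddCommGroup E] [Module ℝ E]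
    (T : Finset ι) (m : ℕ) (f : ι → E) :
    (#T : ℝ) • ∑ S ∈ T.powersetCard m, ∑ i ∈ S, f i =
      ((m : ℝ) * (#T).choose m) • ∑ i ∈ T, f i := by
  have h : ∑ S ∈ T.powersetCard m, ∑ i ∈ S, f i =
      ∑ i ∈ T, (#{S ∈ T.powersetCard m | i ∈ S} : ℝ) • f i := by
    have h1 : ∀ S ∈ T.powersetCard m, ∑ i ∈ S, f i = ∑ i ∈ T, if i ∈ S then f i else 0 := by
      intro S hS
      rw [sum_ite_mem, inter_eq_right.2 (mem_powersetCard.1 hS).1]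
    rw [sum_congr rfl h1, sum_comm]
    exact sum_congr rfl fun i _ => by
      rw [← sum_filter, sum_const, ← Nat.cast_smul_eq_nsmul ℝ]
  rw [h, smul_sum, smul_sum]
  exact sum_congr rfl fun i hi => by
    rw [smul_smul, mul_comm, card_filter_mem_powersetCard T m hi]

open Finset in
-- A diagonal pair lies in a random `m`-subset with probability `m / #T`, an off-diagonal one with
-- probability `m (m - 1) / (#T (#T - 1))`. Extending the second weight to all pairs leaves an
-- excess proportional to `#T - m` on the diagonal.
theorem sum_powersetCard_sum_sum {ι : Type*} [DecidableEq ι] (T : Finset ι) (m : ℕ)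
    (f : ι → ι → ℝ) :
    (#T : ℝ) * (#T - 1) * ∑ S ∈ T.powersetCard m, ∑ i ∈ S, ∑ j ∈ S, f i j =
      m * (#T).choose m * ((#T - m) * ∑ i ∈ T, f i i + (m - 1) * ∑ i ∈ T, ∑ j ∈ T, f i j) := by
  have h : ∑ S ∈ T.powersetCard m, ∑ i ∈ S, ∑ j ∈ S, f i j =
      ∑ i ∈ T, ∑ j ∈ T, (#{S ∈ T.powersetCard m | i ∈ S ∧ j ∈ S} : ℝ) * f i j := by
    have h1 : ∀ S ∈ T.powersetCard m, ∑ i ∈ S, ∑ j ∈ S, f i j =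
        ∑ i ∈ T, ∑ j ∈ T, if i ∈ S ∧ j ∈ S then f i j else 0 := by
      intro S hS
      have hST := inter_eq_right.2 (mem_powersetCard.1 hS).1
      have h2 : ∀ i, (∑ j ∈ T, if i ∈ S ∧ j ∈ S then f i j else 0) =
          if i ∈ S then ∑ j ∈ S, f i j else 0 := by
        intro i
        split_ifs with hi
        · simp only [hi, true_and]
          rw [sum_ite_mem, hST]
        · simp [hi]
      simp only [h2]
      rw [sum_ite_mem, hST]
    rw [sum_congr rfl h1, sum_comm]
    refine sum_congr rfl fun i _ => ?_
    rw [sum_comm]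
    exact sum_congr rfl fun j _ => by rw [← sum_filter, sum_const, nsmul_eq_mul]
  have h2 : ∀ i ∈ T, ∀ j ∈ T,
      (#T : ℝ) * (#T - 1) * ((#{S ∈ T.powersetCard m | i ∈ S ∧ j ∈ S} : ℝ) * f i j) =
      m * (#T).choose m * ((if i = j then (#T - m) * f i j else 0) + (m - 1) * f i j) := by
    intro i hi j hj
    split_ifs with hij
    · subst hij
      have := card_filter_mem_powersetCard T m hi
      simp only [and_self]
      linear_combination ((#T : ℝ) - 1) * f i i * this
    · have := card_filter_mem_mem_powersetCard T m hi hj hij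
      linear_combination f i j * this
  rw [h]
  simp only [mul_sum]
  rw [sum_congr rfl fun i hi => sum_congr rfl fun j hj => h2 i hi j hj]
  simp only [← mul_sum, sum_add_distrib, sum_ite_eq]
  congr 2
  rw [mul_sum]
  exact sum_congr rfl fun i hi => by rw [if_pos hi]

open Finset in
/-- Mean of `‖∑ i ∈ S, v i + z‖ ^ 2` over the `m`-element subsets `S` of `T`. -/
theorem sum_powersetCard_norm_add_sq {ι E : Type*} [DecidableEq ι] [NormedAddCommGroup E]
    [InnerProductSpace ℝ E] (T : Finset ι) (m : ℕ) (hT : 2 ≤ #T) (v : ι → E) (z : E) :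
    ∑ S ∈ T.powersetCard m, ‖∑ i ∈ S, v i + z‖ ^ 2 =
      (#T).choose m * (m / #T * (((#T - m) * ∑ i ∈ T, ‖v i‖ ^ 2 +
        (m - 1) * ‖∑ i ∈ T, v i‖ ^ 2) / (#T - 1)) +
        2 * (m / #T) * inner ℝ (∑ i ∈ T, v i) z + ‖z‖ ^ 2) := by
  have hT' : (2 : ℝ) ≤ #T := by exact_mod_cast hT
  have key : ∀ S : Finset ι, ‖∑ i ∈ S, v i‖ ^ 2 = ∑ i ∈ S, ∑ j ∈ S, inner ℝ (v i) (v j) := by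
    intro S
    rw [← real_inner_self_eq_norm_sq, sum_inner]
    exact sum_congr rfl fun i _ => inner_sum _ _ _
  have h1 := sum_powersetCard_sum_sum T m fun i j => inner ℝ (v i) (v j)
  have h2 := congrArg (fun y => inner ℝ y z) (sum_powersetCard_sum T m v)
  simp only [real_inner_smul_left] at h2
  simp only [real_inner_self_eq_norm_sq, ← key] at h1
  simp only [norm_add_sq_real, sum_add_distrib, ← mul_sum, ← sum_inner, sum_const, nsmul_eq_mul,
    card_powersetCard]
  have hs : (#T : ℝ) ≠ 0 := by positivity
  have hs1 : (#T : ℝ) - 1 ≠ 0 := by linarith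
  have e1 := eq_div_of_mul_eq (mul_ne_zero hs hs1) ((mul_comm _ _).trans h1)
  have e2 := eq_div_of_mul_eq hs ((mul_comm _ _).trans h2)
  rw [e1, e2]
  field_simp

/-! ### Sparse convex decomposition. -/

/-- A point of the box `[0, 1] ^ A` of total mass at most `b` is a convex combination of points of
the box with at most `b` nonzero coordinates. -/
theorem mem_convexHull_sparse_box {ι : Type*} [Fintype ι] [DecidableEq ι] (A : Finset ι) (b : ℕ)
    (y : ι → ℝ) (h0 : ∀ i, 0 ≤ y i) (h1 : ∀ i, y i ≤ 1) (hA : ∀ i ∉ A, y i = 0)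
    (hsum : ∑ i, y i ≤ b) :
    y ∈ convexHull ℝ {u : ι → ℝ | (∀ i, 0 ≤ u i) ∧ (∀ i, u i ≤ 1) ∧ (∀ i ∉ A, u i = 0) ∧
      (Finset.univ.filter fun i => u i ≠ 0).card ≤ b} := by
  -- The induction is on the number of fractional coordinates, those different from 0 and 1.
  induction hn : (Finset.univ.filter fun i => y i ≠ 0 ∧ y i ≠ 1).card using Nat.strong_induction_on
    generalizing y with
  | _ n ih =>
  by_cases hc : (Finset.univ.filter fun i => y i ≠ 0).card ≤ b
  · exact subset_convexHull ℝ _ ⟨h0, h1, hA, hc⟩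
  have hmove : ∀ i j, i ≠ j → y i ≠ 0 → y i ≠ 1 → y j ≠ 0 → y j ≠ 1 →
      y + min (1 - y i) (y j) • (Pi.single i 1 - Pi.single j 1) ∈
        convexHull ℝ {u : ι → ℝ | (∀ i, 0 ≤ u i) ∧ (∀ i, u i ≤ 1) ∧ (∀ i ∉ A, u i = 0) ∧
          (Finset.univ.filter fun i => u i ≠ 0).card ≤ b} := by
    intro i j hij hi0 hi1 hj0 hj1
    -- The largest mass that can pass from `j` to `i` inside the box; one of the two coordinates
    -- then stops being fractional.
    set ε := min (1 - y i) (y j) with hε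
    set y' := y + ε • (Pi.single i 1 - Pi.single j 1 : ι → ℝ) with hy'
    have hi : y' i = y i + ε := by simp [hy', hij]
    have hj : y' j = y j - ε := by simp [hy', hij.symm, sub_eq_add_neg]
    have ho : ∀ m, m ≠ i → m ≠ j → y' m = y m := by
      intro m hmi hmj; simp [hy', hmi, hmj]
    have hε0 : 0 ≤ ε := le_min (by linarith [h1 i]) (h0 j)
    have hεi : ε ≤ 1 - y i := min_le_left _ _
    have hεj : ε ≤ y j := min_le_right _ _
    have hall : ∀ (p : ι → Prop), p i → p j → (∀ m, m ≠ i → m ≠ j → p m) → ∀ m, p m := by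
      intro p hpi hpj hpo m
      by_cases hmi : m = i
      · exact hmi ▸ hpi
      by_cases hmj : m = j
      · exact hmj ▸ hpj
      exact hpo m hmi hmj
    refine ih _ ?_ y' ?_ ?_ ?_ ?_ rfl
    · rw [← hn]
      refine Finset.card_lt_card (Finset.ssubset_iff_of_subset ?_ |>.2 ?_)
      · intro m
        simp only [Finset.mem_filter, Finset.mem_univ, true_and]
        revert m
        refine hall _ (fun _ => ⟨hi0, hi1⟩) (fun _ => ⟨hj0, hj1⟩) fun m hmi hmj => ?_
        rw [ho m hmi hmj]; exact id
      · rcases min_choice (1 - y i) (y j) with h | h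
        · exact ⟨i, by simp [hi0, hi1], by simp [hi, hε, h]⟩
        · exact ⟨j, by simp [hj0, hj1], by simp [hj, hε, h]⟩
    · exact hall _ (by rw [hi]; linarith [h0 i]) (by rw [hj]; linarith)
        fun m hmi hmj => by rw [ho m hmi hmj]; exact h0 m
    · exact hall _ (by rw [hi]; linarith) (by rw [hj]; linarith [h1 j])
        fun m hmi hmj => by rw [ho m hmi hmj]; exact h1 m
    · exact hall _ (fun h => absurd (hA i h) hi0) (fun h => absurd (hA j h) hj0)
        fun m hmi hmj h => by rw [ho m hmi hmj]; exact hA m h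
    · have : ∑ m, y' m = ∑ m, y m := by
        simp [hy', Finset.sum_add_distrib, ← Finset.mul_sum, Finset.sum_sub_distrib]
      rw [this]; exact hsum
  obtain ⟨i, j, hij, hi0, hi1, hj0, hj1⟩ :
      ∃ i j, i ≠ j ∧ y i ≠ 0 ∧ y i ≠ 1 ∧ y j ≠ 0 ∧ y j ≠ 1 := by
    by_contra! hcon
    -- With more than `b` nonzero coordinates and mass at most `b`, the total deficit from 1 on the
    -- support is at least 1. A single fractional coordinate contributes less than 1, so there are
    -- two.
    have hdef : ((Finset.univ.filter fun i => y i ≠ 0).card : ℝ) - ∑ i, y i =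
        ∑ i, if y i ≠ 0 then 1 - y i else 0 := by
      rw [Finset.card_filter]
      push_cast
      rw [← Finset.sum_sub_distrib]
      exact Finset.sum_congr rfl fun i _ => by split_ifs with h <;> simp_all
    have hge : (1 : ℝ) ≤ ∑ i, if y i ≠ 0 then 1 - y i else 0 := by
      have : ((b + 1 : ℕ) : ℝ) ≤ (Finset.univ.filter fun i => y i ≠ 0).card := by
        exact_mod_cast not_le.1 hc
      push_cast at this
      linarith
    by_cases hf : ∃ i, y i ≠ 0 ∧ y i ≠ 1
    · obtain ⟨i, hi0, hi1⟩ := hf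
      rw [Finset.sum_eq_single i] at hge
      · rw [if_pos hi0] at hge
        exact hi0 (le_antisymm (by linarith) (h0 i))
      · intro j _ hji
        split_ifs with hj0
        · rw [hcon i j hji.symm hi0 hi1 hj0, sub_self]
        · rfl
      · simp
    · push Not at hf
      rw [Finset.sum_eq_zero] at hge
      · linarith
      · intro j _
        split_ifs with hj0
        · rw [hf j hj0, sub_self]
        · rfl
  have hp := hmove i j hij hi0 hi1 hj0 hj1
  have hq := hmove j i hij.symm hj0 hj1 hi0 hi1
  have hε : 0 < min (1 - y i) (y j) :=
    lt_min (by linarith [lt_of_le_of_ne (h1 i) hi1]) (lt_of_le_of_ne (h0 j) hj0.symm)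
  have hε' : 0 < min (1 - y j) (y i) :=
    lt_min (by linarith [lt_of_le_of_ne (h1 j) hj1]) (lt_of_le_of_ne (h0 i) hi0.symm)
  set ε := min (1 - y i) (y j)
  set ε' := min (1 - y j) (y i)
  -- The transfers `i ← j` of size `ε` and `j ← i` of size `ε'` cancel with these weights, so `y`
  -- lies between the two moved points.
  have := convex_convexHull ℝ _ hp hq (a := ε' / (ε + ε')) (b := ε / (ε + ε')) (by positivity)
    (by positivity) (by field_simp; ring)
  convert this using 1
  ext m
  simp only [Pi.add_apply, Pi.smul_apply, Pi.sub_apply, smul_eq_mul]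
  field_simp
  ring

end BlockCS

end

/-! ### Restricted isometry estimates for kernel coefficient vectors. -/

noncomputable section

namespace BlockCS

/-- The restricted isometry bounds of order `k` with constant `δ` for the coefficient vectors that
are supported on the support of `a`. -/
def IsRIPOn {ι E : Type*} [Fintype ι] [NormedAddCommGroup E] [InnerProductSpace ℝ E]
    (w : ι → E) (a : ι → ℝ) (k : ℕ) (δ : ℝ) : Prop :=
  ∀ c : ι → ℝ, (∀ i, a i = 0 → c i = 0) → (Finset.univ.filter fun i => c i ≠ 0).card ≤ k →
    (1 - δ) * ∑ i, c i ^ 2 ≤ ‖∑ i, c i • w i‖ ^ 2 ∧ ‖∑ i, c i • w i‖ ^ 2 ≤ (1 + δ) * ∑ i, c i ^ 2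

open Finset

variable {ι E : Type*} [Fintype ι] [DecidableEq ι] [NormedAddCommGroup E] [InnerProductSpace ℝ E]

/-- For `#T = s`, the quotient `E ‖∑ i ∈ S, v i‖ ^ 2 / (m / s)` for a uniformly random `m`-element
subset `S` of `T`. -/
def subsetEnergy (T : Finset ι) (v : ι → E) (m : ℝ) : ℝ :=
  ((#T - m) * ∑ i ∈ T, ‖v i‖ ^ 2 + (m - 1) * ‖∑ i ∈ T, v i‖ ^ 2) / (#T - 1)

/-- Restricted isometry bounds averaged over the `m`-element subsets of `T`. -/
theorem IsRIPOn.average {w : ι → E} {a : ι → ℝ} {k : ℕ} {δ : ℝ} (h : IsRIPOn w a k δ)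
    {T : Finset ι} (hT : 2 ≤ #T) {m b : ℕ} (hm : m ≤ #T) (hmb : m + b ≤ k) {u : ι → ℝ}
    (huT : ∀ i ∈ T, u i = 0) (hua : ∀ i, a i = 0 → u i = 0)
    (hub : #{i | u i ≠ 0} ≤ b) (γ : ℝ) :
    (1 - δ) * (m / #T * ∑ i ∈ T, a i ^ 2 + γ ^ 2 * ∑ i, u i ^ 2) ≤
        m / #T * subsetEnergy T (fun i => a i • w i) m +
        2 * γ * (m / #T) * inner ℝ (∑ i ∈ T, a i • w i) (∑ i, u i • w i) +
        γ ^ 2 * ‖∑ i, u i • w i‖ ^ 2 ∧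
    m / #T * subsetEnergy T (fun i => a i • w i) m +
        2 * γ * (m / #T) * inner ℝ (∑ i ∈ T, a i • w i) (∑ i, u i • w i) +
        γ ^ 2 * ‖∑ i, u i • w i‖ ^ 2 ≤
      (1 + δ) * (m / #T * ∑ i ∈ T, a i ^ 2 + γ ^ 2 * ∑ i, u i ^ 2) := by
  have hT' : (2 : ℝ) ≤ #T := by exact_mod_cast hT
  have hC : (0 : ℝ) < (#T).choose m := by exact_mod_cast Nat.choose_pos hm
  set z := ∑ i, u i • w i with hz
  have hS : ∀ S ∈ T.powersetCard m,
      (1 - δ) * (∑ i ∈ S, a i ^ 2 + γ ^ 2 * ∑ i, u i ^ 2) ≤ ‖∑ i ∈ S, a i • w i + γ • z‖ ^ 2 ∧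
      ‖∑ i ∈ S, a i • w i + γ • z‖ ^ 2 ≤ (1 + δ) * (∑ i ∈ S, a i ^ 2 + γ ^ 2 * ∑ i, u i ^ 2) := by
    intro S hS
    obtain ⟨hST, hSm⟩ := mem_powersetCard.1 hS
    have hsq : ∑ i, ((if i ∈ S then a i else 0) + γ * u i) ^ 2 =
        ∑ i ∈ S, a i ^ 2 + γ ^ 2 * ∑ i, u i ^ 2 := by
      have e : ∀ i, ((if i ∈ S then a i else 0) + γ * u i) ^ 2 =
          (if i ∈ S then a i ^ 2 else 0) + γ ^ 2 * u i ^ 2 := by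
        intro i
        split_ifs with hi
        · rw [huT i (hST hi)]; ring
        · ring
      simp only [e, sum_add_distrib, ← mul_sum, sum_ite_mem, univ_inter]
    have hvec : ∑ i, ((if i ∈ S then a i else 0) + γ * u i) • w i =
        ∑ i ∈ S, a i • w i + γ • z := by
      simp only [add_smul, sum_add_distrib, mul_smul, ← smul_sum, ite_smul, zero_smul,
        sum_ite_mem, univ_inter, hz]
    have := h (fun i => (if i ∈ S then a i else 0) + γ * u i)
      (fun i hi => by simp [hi, hua i hi]) (by
        refine le_trans (card_le_card (t := S ∪ ({i | u i ≠ 0} : Finset ι)) ?_)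
          ((card_union_le _ _).trans (by omega))
        intro i hi
        simp only [mem_filter, mem_univ, true_and, mem_union] at hi ⊢
        by_contra! hcon
        exact hi (by simp [hcon.1, hcon.2]))
    rwa [hsq, hvec] at this
  have hav := sum_powersetCard_norm_add_sq T m hT (fun i => a i • w i) (γ • z)
  have hX := sum_powersetCard_sum T m fun i => a i ^ 2
  simp only [smul_eq_mul] at hX
  have hX' : ∑ S ∈ T.powersetCard m, (∑ i ∈ S, a i ^ 2 + γ ^ 2 * ∑ i, u i ^ 2) =
      (#T).choose m * (m / #T * ∑ i ∈ T, a i ^ 2 + γ ^ 2 * ∑ i, u i ^ 2) := by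
    rw [sum_add_distrib, sum_const, card_powersetCard, nsmul_eq_mul]
    have hs : (#T : ℝ) ≠ 0 := by positivity
    rw [eq_div_of_mul_eq hs ((mul_comm _ _).trans hX)]
    field_simp
  have hlow := sum_le_sum fun S hS' => (hS S hS').1
  have hupp := sum_le_sum fun S hS' => (hS S hS').2
  rw [← mul_sum, hX', hav, mul_left_comm] at hlow
  rw [← mul_sum, hX', hav, mul_left_comm] at hupp
  have hlow := le_of_mul_le_mul_left hlow hC
  have hupp := le_of_mul_le_mul_left hupp hC
  have hnorm : ‖γ • z‖ ^ 2 = γ ^ 2 * ‖z‖ ^ 2 := by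
    rw [norm_smul, mul_pow, Real.norm_eq_abs, sq_abs]
  rw [real_inner_smul_right, hnorm] at hlow hupp
  rw [subsetEnergy]
  constructor <;> linarith

/-- The part of `a` off `T` is a mean of `b`-sparse vectors of controlled energy. -/
theorem exists_sparse_mean {a : ι → ℝ} (ha : ∀ i, 0 ≤ a i) {T : Finset ι}
    (hT : ∀ i ∈ T, ∀ j ∉ T, a j ≤ a i) (hsum : ∑ i ∈ Tᶜ, a i ≤ ∑ i ∈ T, a i)
    (hpos : 0 < ∑ i ∈ T, a i) {b : ℕ} (hb : 1 ≤ b) (hbT : b ≤ #T) :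
    ∃ (κ : Type) (_ : Fintype κ) (p : κ → ℝ) (u : κ → ι → ℝ), (∀ j, 0 ≤ p j) ∧ ∑ j, p j = 1 ∧
      (∀ j, ∀ i ∈ T, u j i = 0) ∧ (∀ j i, a i = 0 → u j i = 0) ∧ (∀ j, #{i | u j i ≠ 0} ≤ b) ∧
      (∀ j, b * ∑ i, u j i ^ 2 ≤ #T * ∑ i ∈ T, a i ^ 2) ∧
      ∀ i, ∑ j, p j * u j i = if i ∈ T then 0 else a i := by
  have hb' : (1 : ℝ) ≤ b := by exact_mod_cast hb
  have hbT' : (b : ℝ) ≤ #T := by exact_mod_cast hbT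
  -- At this scale the tail divided by `β` has mass at most `b`, and its entries are at most 1: each
  -- is at most the mean over the head, which is at most `β` since `b ≤ #T`.
  set β := (∑ i ∈ T, a i) / b with hβ
  have hβ0 : 0 < β := by positivity
  have hβb : β * b = ∑ i ∈ T, a i := by rw [hβ]; field_simp
  have hmem := mem_convexHull_sparse_box ({i | i ∉ T ∧ a i ≠ 0} : Finset ι) b
    (fun i => if i ∈ T then 0 else a i / β) (fun i => by
      split_ifs
      · rfl
      · exact div_nonneg (ha i) hβ0.le) (fun j => by
      split_ifs with hj
      · exact zero_le_one
      · rw [div_le_one hβ0, hβ, le_div_iff₀ (by linarith)]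
        have := card_nsmul_le_sum T a (a j) fun i hi => hT i hi j hj
        rw [nsmul_eq_mul] at this
        nlinarith [ha j]) (fun i hi => by
      simp only [mem_filter, mem_univ, true_and, not_and, not_not] at hi
      split_ifs with hiT
      · rfl
      · rw [hi hiT, zero_div]) (by
      have : ∑ i, (if i ∈ T then 0 else a i / β) = (∑ i ∈ Tᶜ, a i) / β := by
        rw [sum_div, ← sum_add_sum_compl T, sum_eq_zero, zero_add]
        · exact sum_congr rfl fun i hi => by rw [if_neg (mem_compl.1 hi)]
        · exact fun i hi => if_pos hi
      rw [this, div_le_iff₀ hβ0]; linarith)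
  obtain ⟨κ, hκ, p, u, hp, hp1, hu, hpu⟩ := mem_convexHull_iff_exists_fintype.1 hmem
  have hu0 : ∀ j i, (i ∈ T ∨ a i = 0) → u j i = 0 := by
    intro j i hi
    refine (hu j).2.2.1 i ?_
    simp only [mem_filter, mem_univ, true_and, not_and, not_not]
    tauto
  refine ⟨κ, hκ, p, fun j i => β * u j i, hp, hp1, fun j i hi => by simp [hu0 j i (.inl hi)],
    fun j i hi => by simp [hu0 j i (.inr hi)], fun j => ?_, fun j => ?_, fun i => ?_⟩
  · simpa [hβ0.ne'] using (hu j).2.2.2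
  · obtain ⟨h0, h1, -, hc⟩ := hu j
    have h2 : ∑ i, u j i ^ 2 ≤ b := by
      calc ∑ i, u j i ^ 2 ≤ ∑ i, (if u j i ≠ 0 then 1 else 0 : ℝ) := by
            refine sum_le_sum fun i _ => ?_
            split_ifs with hi
            · exact pow_le_one₀ (h0 i) (h1 i)
            · simp [not_not.1 hi]
        _ = (#{i | u j i ≠ 0} : ℝ) := by rw [card_filter]; push_cast; rfl
        _ ≤ b := by exact_mod_cast hc
    have h3 : (∑ i ∈ T, a i) ^ 2 ≤ #T * ∑ i ∈ T, a i ^ 2 := sq_sum_le_card_mul_sum_sq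
    simp only [mul_pow, ← mul_sum]
    calc (b : ℝ) * (β ^ 2 * ∑ i, u j i ^ 2) ≤ b * (β ^ 2 * b) := by gcongr
      _ = (∑ i ∈ T, a i) ^ 2 := by rw [← hβb]; ring
      _ ≤ _ := h3
  · have := congrFun hpu i
    simp only [Finset.sum_apply, Pi.smul_apply, smul_eq_mul] at this
    calc ∑ j, p j * (β * u j i) = β * ∑ j, p j * u j i := by
          rw [mul_sum]; exact sum_congr rfl fun j _ => by ring
      _ = _ := by
          rw [this]; split_ifs
          · simp
          · field_simp

/-- The main estimate: compare the vectors `x_S - (m / s) u` and `x_S + (b / s) u`, with `x_S` an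
`m`-element part of the head of the kernel vector `a` and `u` a `b`-sparse part of its tail. -/
theorem IsRIPOn.head_le {w : ι → E} {a : ι → ℝ} {k : ℕ} {δ : ℝ} (h : IsRIPOn w a k δ)
    (hδ : 0 ≤ δ) (ha : ∀ i, 0 ≤ a i) (hker : ∑ i, a i • w i = 0) {T : Finset ι} (hT2 : 2 ≤ #T)
    (hT : ∀ i ∈ T, ∀ j ∉ T, a j ≤ a i) (hsum : ∑ i ∈ Tᶜ, a i ≤ ∑ i ∈ T, a i)
    (hpos : 0 < ∑ i ∈ T, a i) {m b : ℕ} (hm : 1 ≤ m) (hmT : m ≤ #T) (hb : 1 ≤ b) (hbT : b ≤ #T)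
    (hk : m + b ≤ k) :
    (b - m) * subsetEnergy T (fun i => a i • w i) m +
      2 * m * b / #T * ‖∑ i ∈ T, a i • w i‖ ^ 2 ≤ (b - m + δ * (m + b)) * ∑ i ∈ T, a i ^ 2 := by
  obtain ⟨κ, _, p, u, hp, hp1, huT, hua, hub, hue, hmean⟩ :=
    exists_sparse_mean ha hT hsum hpos hb hbT
  have hs : (0 : ℝ) < #T := by exact_mod_cast (by omega : 0 < #T)
  have hb' : (0 : ℝ) < b := by exact_mod_cast hb
  have hm' : (0 : ℝ) < m := by exact_mod_cast hm
  set x := ∑ i ∈ T, a i • w i with hx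
  set z := fun j => ∑ i, u j i • w i with hz
  have hzmean : ∑ j, p j • z j = -x := by
    have h1 : ∑ j, p j • z j = ∑ i, (if i ∈ T then 0 else a i) • w i := by
      simp only [hz, smul_sum, smul_smul]
      rw [sum_comm]
      exact sum_congr rfl fun i _ => by rw [← sum_smul, hmean]
    have h2 : ∑ i, (if i ∈ T then 0 else a i) • w i + x = ∑ i, a i • w i := by
      rw [hx, ← sum_add_sum_compl T, ← sum_add_sum_compl T fun i => a i • w i, sum_eq_zero, zero_add,
        add_comm]
      · congr 1
        exact sum_congr rfl fun i hi => by rw [if_neg (mem_compl.1 hi)]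
      · exact fun i hi => by rw [if_pos hi, zero_smul]
    rw [h1]
    exact eq_neg_of_add_eq_zero_left (h2.trans hker)
  set U := ∑ j, p j * ‖z j‖ ^ 2 with hU
  set V := ∑ j, p j * ∑ i, u j i ^ 2 with hV
  set X := ∑ i ∈ T, a i ^ 2 with hX
  set G := subsetEnergy T (fun i => a i • w i) m with hG
  have hinner : ∑ j, p j * inner ℝ x (z j) = -‖x‖ ^ 2 := by
    rw [← real_inner_self_eq_norm_sq, ← inner_neg_right, ← hzmean, inner_sum]
    exact sum_congr rfl fun j _ => (real_inner_smul_right _ _ _).symm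
  have hVX : b * V ≤ #T * X := by
    calc (b : ℝ) * V = ∑ j, p j * (b * ∑ i, u j i ^ 2) := by
          rw [hV, mul_sum]; exact sum_congr rfl fun j _ => by ring
      _ ≤ ∑ j, p j * (#T * X) := sum_le_sum fun j _ => mul_le_mul_of_nonneg_left (hue j) (hp j)
      _ = #T * X := by rw [← sum_mul, hp1, one_mul]
  have hbounds : ∀ γ : ℝ,
      (1 - δ) * (m / #T * X + γ ^ 2 * V) ≤ m / #T * G - 2 * γ * (m / #T) * ‖x‖ ^ 2 + γ ^ 2 * U ∧
      m / #T * G - 2 * γ * (m / #T) * ‖x‖ ^ 2 + γ ^ 2 * U ≤ (1 + δ) * (m / #T * X + γ ^ 2 * V) := by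
    intro γ
    have hav := fun j => h.average hT2 hmT hk (huT j) (hua j) (hub j) γ
    have e1 : ∀ C : ℝ, ∑ j, p j * (C * (m / #T * X + γ ^ 2 * ∑ i, u j i ^ 2)) =
        C * (m / #T * X + γ ^ 2 * V) := by
      intro C
      have e : ∀ j, p j * (C * (m / #T * X + γ ^ 2 * ∑ i, u j i ^ 2)) =
          C * (m / #T * X) * p j + C * γ ^ 2 * (p j * ∑ i, u j i ^ 2) := fun j => by ring
      rw [sum_congr rfl fun j _ => e j, sum_add_distrib, ← mul_sum, ← mul_sum, hp1]
      ring
    have e2 : ∑ j, p j * (m / #T * G + 2 * γ * (m / #T) * inner ℝ x (z j) + γ ^ 2 * ‖z j‖ ^ 2) =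
        m / #T * G - 2 * γ * (m / #T) * ‖x‖ ^ 2 + γ ^ 2 * U := by
      calc _ = m / #T * G * ∑ j, p j + 2 * γ * (m / #T) * ∑ j, p j * inner ℝ x (z j) +
              γ ^ 2 * U := by
            rw [hU, mul_sum, mul_sum, mul_sum, ← sum_add_distrib, ← sum_add_distrib]
            exact sum_congr rfl fun j _ => by ring
        _ = _ := by rw [hp1, hinner]; ring
    rw [← e1, ← e1, ← e2]
    exact ⟨sum_le_sum fun j _ => mul_le_mul_of_nonneg_left (hav j).1 (hp j),
      sum_le_sum fun j _ => mul_le_mul_of_nonneg_left (hav j).2 (hp j)⟩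
  -- With weights `b ^ 2` and `m ^ 2`, both choices of `γ` give `U` the coefficient `(m b / #T) ^
  -- 2`, so it cancels in the difference. The `V` terms do not cancel but add up to `2 δ (m b / #T)
  -- ^ 2 V`, which `hVX` absorbs into `X`.
  have hup := (hbounds (-(m / #T))).2
  have hlow := (hbounds (b / #T)).1
  have h1 := mul_le_mul_of_nonneg_left hup (sq_nonneg (b : ℝ))
  have h2 := mul_le_mul_of_nonneg_left hlow (sq_nonneg (m : ℝ))
  have h3 := mul_le_mul_of_nonneg_left hVX (by positivity : 0 ≤ 2 * δ * b * m ^ 2 / #T ^ 2)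
  have hfin : (m * (m + b) / #T : ℝ) * ((b - m) * G + 2 * m * b / #T * ‖x‖ ^ 2) ≤
      (m * (m + b) / #T : ℝ) * ((b - m + δ * (m + b)) * X) := by
    have i1 : (m * (m + b) / #T : ℝ) * ((b - m) * G + 2 * m * b / #T * ‖x‖ ^ 2) =
      b ^ 2 * (m / #T * G - 2 * (-(m / #T)) * (m / #T) * ‖x‖ ^ 2 + (-(m / #T)) ^ 2 * U) -
      m ^ 2 * (m / #T * G - 2 * (b / #T) * (m / #T) * ‖x‖ ^ 2 + (b / #T) ^ 2 * U) := by
      field_simp; ring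
    have i2 : (m * (m + b) / #T : ℝ) * ((b - m + δ * (m + b)) * X) =
      b ^ 2 * ((1 + δ) * (m / #T * X + (-(m / #T)) ^ 2 * V)) -
      m ^ 2 * ((1 - δ) * (m / #T * X + (b / #T) ^ 2 * V)) +
      (2 * δ * b * m ^ 2 / #T ^ 2 * (#T * X) - 2 * δ * b * m ^ 2 / #T ^ 2 * (b * V)) := by
      field_simp; ring
    rw [i1, i2]
    linarith
  exact le_of_mul_le_mul_left hfin (by positivity)

/-- Upper bound for the diagonal part of the head, from the pairs `x_i e_i - x_j e_j`. -/
theorem IsRIPOn.card_mul_sum_le {w : ι → E} {a : ι → ℝ} {k : ℕ} {δ : ℝ} (h : IsRIPOn w a k δ)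
    (hk : 2 ≤ k) (T : Finset ι) :
    #T * ∑ i ∈ T, ‖a i • w i‖ ^ 2 - ‖∑ i ∈ T, a i • w i‖ ^ 2 ≤
      (1 + δ) * (#T - 1) * ∑ i ∈ T, a i ^ 2 := by
  have hpair : ∀ i j, ‖a i • w i - a j • w j‖ ^ 2 ≤
      (1 + δ) * (a i ^ 2 + a j ^ 2 - if i = j then 2 * a i ^ 2 else 0) := by
    intro i j
    split_ifs with hij
    · subst hij
      have : a i ^ 2 + a i ^ 2 - 2 * a i ^ 2 = 0 := by ring
      simp [this]
    have hsq : ∑ n, (Pi.single i (a i) - Pi.single j (a j) : ι → ℝ) n ^ 2 = a i ^ 2 + a j ^ 2 := by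
      rw [Fintype.sum_eq_add i j hij fun n hn => by simp [hn.1, hn.2]]
      simp [hij, Ne.symm hij]
    have hvec : ∑ n, (Pi.single i (a i) - Pi.single j (a j) : ι → ℝ) n • w n =
        a i • w i - a j • w j := by
      rw [Fintype.sum_eq_add i j hij fun n hn => by simp [hn.1, hn.2]]
      simp [hij, Ne.symm hij, sub_eq_add_neg]
    -- The test vector has at most two nonzero coordinates, hence the requirement `2 ≤ k`.
    have := (h (Pi.single i (a i) - Pi.single j (a j)) (fun n hn => by
      by_cases h1 : n = i <;> by_cases h2 : n = j <;> simp_all [Pi.single_apply]) (by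
        refine le_trans (card_le_card (t := {i, j}) ?_) (card_le_two.trans hk)
        intro n hn
        simp only [mem_filter, mem_univ, true_and, mem_insert, mem_singleton] at hn ⊢
        by_contra! hcon
        exact hn (by simp [hcon.1, hcon.2]))).2
    rw [hsq, hvec] at this
    simpa using this
  have hsum := sum_le_sum fun i (_ : i ∈ T) => sum_le_sum fun j (_ : j ∈ T) => hpair i j
  have e1 : ∑ i ∈ T, ∑ j ∈ T, ‖a i • w i - a j • w j‖ ^ 2 =
      2 * (#T * ∑ i ∈ T, ‖a i • w i‖ ^ 2 - ‖∑ i ∈ T, a i • w i‖ ^ 2) := by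
    simp only [norm_sub_sq_real, sum_add_distrib, sum_sub_distrib, ← mul_sum, ← inner_sum,
      ← sum_inner, sum_const, nsmul_eq_mul, real_inner_self_eq_norm_sq]
    ring
  have e2 : ∑ i ∈ T, ∑ j ∈ T, (1 + δ) * (a i ^ 2 + a j ^ 2 - if i = j then 2 * a i ^ 2 else 0) =
      2 * ((1 + δ) * (#T - 1) * ∑ i ∈ T, a i ^ 2) := by
    simp only [← mul_sum, sum_add_distrib, sum_sub_distrib, sum_const, nsmul_eq_mul, sum_ite_eq]
    rw [sum_congr rfl fun i hi => if_pos hi, ← mul_sum]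
    ring
  rw [e1, e2] at hsum
  linarith

/-- A kernel vector whose head dominates its tail vanishes, if `δ < k / (4 s - k)` and
`δ < 1 / 2`. -/
theorem IsRIPOn.head_eq_zero {w : ι → E} {a : ι → ℝ} {k : ℕ} {δ : ℝ} (h : IsRIPOn w a k δ)
    (hδ : 0 ≤ δ) (ha : ∀ i, 0 ≤ a i) (hker : ∑ i, a i • w i = 0) {T : Finset ι} (hT2 : 2 ≤ #T)
    (hT : ∀ i ∈ T, ∀ j ∉ T, a j ≤ a i) (hsum : ∑ i ∈ Tᶜ, a i ≤ ∑ i ∈ T, a i) (hk : 2 ≤ k)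
    (hkT : k ≤ 2 * #T) (hδk : δ * (4 * #T - k) < k) (hδ2 : δ < 1 / 2) :
    ∑ i ∈ T, a i = 0 := by
  by_contra hne
  have hpos : 0 < ∑ i ∈ T, a i := lt_of_le_of_ne (sum_nonneg fun i _ => ha i) (Ne.symm hne)
  have hX : 0 < ∑ i ∈ T, a i ^ 2 := by
    obtain ⟨i, hi, hai⟩ := exists_ne_zero_of_sum_ne_zero hne
    exact sum_pos' (fun i _ => sq_nonneg _) ⟨i, hi, by positivity⟩
  have hs : (2 : ℝ) ≤ #T := by exact_mod_cast hT2
  have hs1 : (#T : ℝ) - 1 ≠ 0 := by linarith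
  have hk' : (2 : ℝ) ≤ k := by exact_mod_cast hk
  have hI := fun m b hm hmT hb hbT hmb =>
    h.head_le hδ ha hker hT2 hT hsum hpos (m := m) (b := b) hm hmT hb hbT hmb
  have havg : ∀ m ≤ #T, 1 ≤ m → m ≤ k →
      (1 - δ) * ∑ i ∈ T, a i ^ 2 ≤ subsetEnergy T (fun i => a i • w i) m := by
    intro m hmT hm hmk
    have := (h.average hT2 hmT (b := 0) (by omega) (u := 0) (by simp) (by simp) (by simp) 0).1
    simp only [ne_eq, OfNat.ofNat_ne_zero, not_false_eq_true, zero_pow, zero_mul, mul_zero,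
      add_zero] at this
    rw [mul_left_comm] at this
    have hm' : (0 : ℝ) < m := by exact_mod_cast hm
    exact le_of_mul_le_mul_left this (by positivity)
  have hfull : subsetEnergy T (fun i => a i • w i) #T = ‖∑ i ∈ T, a i • w i‖ ^ 2 := by
    rw [subsetEnergy]; field_simp; ring
  have hD := h.card_mul_sum_le hk T
  set X := ∑ i ∈ T, a i ^ 2
  set P := ‖∑ i ∈ T, a i • w i‖ ^ 2
  -- The extreme split `m = #T`, `b = k - #T`: the only subset is `T` itself, so its energy is `P`.
  have htail : #T < k → (3 * k - 4 * #T) * P ≤ (k - 2 * #T + δ * k) * X := by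
    intro hlt
    have := hI #T (k - #T) (by omega) le_rfl (by omega) (by omega) (by omega)
    rw [hfull, Nat.cast_sub hlt.le] at this
    have e : (2 * (#T : ℝ) * (k - #T) / #T) = 2 * (k - #T) := by field_simp
    rw [e] at this
    linarith
  -- The sign of `3 k - 4 #T` decides whether `htail` bounds `P` from above or below. In the first
  -- case `P ≥ (1 - δ) X` turns it into `(k - #T) (1 - 2 δ) X ≤ 0`.
  rcases le_or_gt (4 * #T) (3 * k) with h43 | h43
  · have h1 := htail (by omega)
    have h2 := havg #T le_rfl (by omega) (by omega)
    rw [hfull] at h2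
    have h43' : (4 * #T : ℝ) ≤ 3 * k := by exact_mod_cast h43
    have h3 := mul_le_mul_of_nonneg_left h2 (by linarith : (0 : ℝ) ≤ 3 * k - 4 * #T)
    have h4 : 0 < (k - #T : ℝ) * (1 - 2 * δ) * X := by
      have : 0 < (k - #T : ℝ) := by linarith
      have : 0 < 1 - 2 * δ := by linarith
      positivity
    linarith
  · have h43' : (3 * k : ℝ) < 4 * #T := by exact_mod_cast h43
    obtain ⟨m, b, hmb, hm, hb, hbm, hmb1⟩ : ∃ m b, m + b = k ∧ 1 ≤ m ∧ 1 ≤ b ∧ b ≤ m ∧ m ≤ b + 1 :=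
      ⟨(k + 1) / 2, k / 2, by omega, by omega, by omega, by omega, by omega⟩
    have hmT : m ≤ #T := by omega
    have hbT : b ≤ #T := by omega
    have hmbk : (k : ℝ) = m + b := by exact_mod_cast hmb.symm
    have h1 := hI m b hm hmT hb hbT hmb.le
    have h2 := hI b m hb hbT hm hmT (by omega)
    have hsq : ((m : ℝ) - b) ^ 2 ≤ 1 := by
      have hbm' : (b : ℝ) ≤ m := by exact_mod_cast hbm
      have hmb1' : (m : ℝ) ≤ b + 1 := by exact_mod_cast hmb1
      nlinarith
    have hm'' : (m : ℝ) ≤ #T := by exact_mod_cast hmT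
    have hb'' : (b : ℝ) ≤ #T := by exact_mod_cast hbT
    refine ric_scalar_contradiction (P := P) (X := X) (δ := δ) (s := #T) (k := k) (a := m) (b := b)
      (by exact_mod_cast hm) (by exact_mod_cast hb) hsq hmbk h43' hX hδk ?_ ?_
    -- The weights `#T - b` and `#T - m` on the two orders of the split cancel the diagonal sum `∑
    -- ‖a i • w i‖ ^ 2`.
    · have h3 := mul_le_mul_of_nonneg_left h1 (by linarith : (0 : ℝ) ≤ #T - b)
      have h4 := mul_le_mul_of_nonneg_left h2 (by linarith : (0 : ℝ) ≤ #T - m)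
      have e : (-((m : ℝ) - b) ^ 2 + 2 * m * b * (2 * #T - k) / #T) * P =
        (#T - b) * ((b - m) * subsetEnergy T (fun i => a i • w i) m + 2 * m * b / #T * P) +
        (#T - m) * ((m - b) * subsetEnergy T (fun i => a i • w i) b + 2 * b * m / #T * P) := by
        rw [subsetEnergy, subsetEnergy, hmbk]; field_simp; ring
      rw [e, hmbk]
      linarith
    · rcases le_or_gt k #T with hkT' | hkT'
      · left
        -- The average over `k`-subsets involves the diagonal sum with weight `#T - k ≥ 0`; the pair
        -- bound `hD` removes it and leaves a lower bound for `P`.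
        have h5 := havg k hkT' (by omega) le_rfl
        rw [subsetEnergy, le_div_iff₀ (by linarith)] at h5
        have hkT'' : (k : ℝ) ≤ #T := by exact_mod_cast hkT'
        have h6 := mul_le_mul_of_nonneg_left hD (by linarith : (0 : ℝ) ≤ #T - k)
        have h7 := mul_le_mul_of_nonneg_left h5 (by linarith : (0 : ℝ) ≤ #T)
        have h8 : ((#T : ℝ) - 1) * ((k - δ * (2 * #T - k)) * X) ≤ (#T - 1) * (k * P) := by
          linarith
        exact le_of_mul_le_mul_left h8 (by linarith)
      · right
        have := htail hkT'
        linarith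

end BlockCS

end

/-! ### From blocks to coefficients, and the null space property. -/

noncomputable section

namespace BlockCS

open Finset

/-- Among the `s`-element sets there is one carrying the `s` largest values of `a`. -/
theorem exists_top_finset {ι : Type*} [Fintype ι] [DecidableEq ι] (a : ι → ℝ) (ha : ∀ i, 0 ≤ a i)
    {s : ℕ} (hs : s ≤ Fintype.card ι) :
    ∃ T : Finset ι, #T = s ∧ (∀ i ∈ T, ∀ j ∉ T, a j ≤ a i) ∧
      ∀ S : Finset ι, #S ≤ s → ∑ i ∈ S, a i ≤ ∑ i ∈ T, a i := by
  obtain ⟨T, hT, hmax⟩ := exists_max_image (univ.powersetCard s) (fun T : Finset ι => ∑ i ∈ T, a i)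
    (powersetCard_nonempty.2 (by rwa [card_univ]))
  have hTs := (mem_powersetCard.1 hT).2
  refine ⟨T, hTs, fun i hi j hj => ?_, fun S hS => ?_⟩
  · have hj' : j ∉ T.erase i := fun h => hj (mem_of_mem_erase h)
    have := hmax (insert j (T.erase i)) (mem_powersetCard.2 ⟨subset_univ _, by
      rw [card_insert_of_notMem hj', card_erase_add_one hi, hTs]⟩)
    rw [sum_insert hj', ← add_sum_erase T a hi] at this
    linarith
  · obtain ⟨S', hSS', -, hS'⟩ := exists_subsuperset_card_eq (subset_univ S) hS
      (by rwa [card_univ])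
    exact (sum_le_sum_of_subset_of_nonneg hSS' fun i _ _ => ha i).trans
      (hmax S' (mem_powersetCard.2 ⟨subset_univ _, hS'⟩))

variable {l : ℕ} {d : Fin l → ℕ}

theorem norm_sq_eq_sum_block (x : EuclideanSpace ℝ (Fin (∑ i, d i))) :
    ‖x‖ ^ 2 = ∑ i, ‖block d x i‖ ^ 2 := by
  simp only [EuclideanSpace.norm_sq_eq, block]
  rw [← finSigmaFinEquiv.sum_comp, Fintype.sum_sigma]

theorem block_sub (x y : EuclideanSpace ℝ (Fin (∑ i, d i))) (i : Fin l) :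
    block d (x - y) i = block d x i - block d y i := by
  ext j; simp [block]

theorem eq_zero_of_block_eq_zero {x : EuclideanSpace ℝ (Fin (∑ i, d i))}
    (h : ∀ i, ‖block d x i‖ = 0) : x = 0 := by
  have := norm_sq_eq_sum_block x
  simpa [h] using this

/-- Multiply the `i`-th block of `x` by `c i`. -/
def scaleBlocks (d : Fin l → ℕ) (x : EuclideanSpace ℝ (Fin (∑ i, d i))) :
    (Fin l → ℝ) →ₗ[ℝ] EuclideanSpace ℝ (Fin (∑ i, d i)) where
  toFun c := WithLp.toLp 2 fun n => c (finSigmaFinEquiv.symm n).1 * x n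
  map_add' c c' := by ext n; simp [add_mul]
  map_smul' r c := by ext n; simp [mul_assoc]

theorem block_scaleBlocks (x : EuclideanSpace ℝ (Fin (∑ i, d i))) (c : Fin l → ℝ) (i : Fin l) :
    block d (scaleBlocks d x c) i = c i • block d x i := by
  ext j; simp [block, scaleBlocks]

theorem scaleBlocks_eq_self {x : EuclideanSpace ℝ (Fin (∑ i, d i))} {c : Fin l → ℝ}
    (hc : ∀ i, ‖block d x i‖ ≠ 0 → c i = 1) : scaleBlocks d x c = x := by
  refine sub_eq_zero.1 (eq_zero_of_block_eq_zero fun i => ?_)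
  rw [block_sub, block_scaleBlocks]
  by_cases h : ‖block d x i‖ = 0
  · simp [norm_eq_zero.1 h]
  · simp [hc i h]

/-- The images of the normalized blocks of `x`, padded by `s` zero vectors. -/
def blockImages {M : ℕ} (d : Fin l → ℕ) (Φ : Matrix (Fin M) (Fin (∑ i, d i)) ℝ) (s : ℕ)
    (x : EuclideanSpace ℝ (Fin (∑ i, d i))) : Fin l ⊕ Fin s → EuclideanSpace ℝ (Fin M) :=
  Sum.elim (fun i => Matrix.toEuclideanLin Φ (scaleBlocks d x (Pi.single i ‖block d x i‖⁻¹))) 0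

/-- The norms of the blocks of `x`, padded by `s` zeros. -/
def blockNorms (d : Fin l → ℕ) (s : ℕ) (x : EuclideanSpace ℝ (Fin (∑ i, d i))) :
    Fin l ⊕ Fin s → ℝ :=
  Sum.elim (fun i => ‖block d x i‖) 0

theorem sum_smul_blockImages {M : ℕ} (Φ : Matrix (Fin M) (Fin (∑ i, d i)) ℝ) (s : ℕ)
    (x : EuclideanSpace ℝ (Fin (∑ i, d i))) (c : Fin l ⊕ Fin s → ℝ) :
    ∑ i, c i • blockImages d Φ s x i =
      Matrix.toEuclideanLin Φ (scaleBlocks d x fun i => c (.inl i) * ‖block d x i‖⁻¹) := by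
  have h : (fun i => c (.inl i) * ‖block d x i‖⁻¹) =
      ∑ i, c (.inl i) • (Pi.single i ‖block d x i‖⁻¹ : Fin l → ℝ) := by
    ext j
    simp [Finset.sum_apply, Pi.single_apply]
  rw [h, map_sum, map_sum, Fintype.sum_sum_type]
  simp [blockImages]

/-- A coefficient vector `c` is realized by the vector whose `i`-th block is `c i` times the
normalized block of `x`. A zero block cannot be normalized and a padding index has no block, so
norms and sparsity agree only because `c` vanishes wherever `blockNorms` does. -/
theorem isRIPOn_blockImages {M : ℕ} (Φ : Matrix (Fin M) (Fin (∑ i, d i)) ℝ) (s k : ℕ)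
    (x : EuclideanSpace ℝ (Fin (∑ i, d i))) :
    IsRIPOn (blockImages d Φ s x) (blockNorms d s x) k (blockRIC d Φ k) := by
  intro c hc hck
  have hr : ∀ i, c (.inr i) = 0 := fun i => hc _ rfl
  have hl : ∀ i, ‖block d x i‖ = 0 → c (.inl i) = 0 := fun i hi => hc _ hi
  set y := scaleBlocks d x fun i => c (.inl i) * ‖block d x i‖⁻¹ with hy
  have hb : ∀ i, ‖block d y i‖ = |c (.inl i)| := by
    intro i
    rw [hy, block_scaleBlocks, norm_smul, Real.norm_eq_abs]
    by_cases h : ‖block d x i‖ = 0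
    · simp [h, hl i h]
    · rw [abs_mul, abs_inv, abs_norm, inv_mul_cancel_right₀ h]
  have hsq : ∑ i, c i ^ 2 = ‖y‖ ^ 2 := by
    rw [norm_sq_eq_sum_block, Fintype.sum_sum_type]
    simp [hr, hb]
  have hsp : IsBlockSparse d k y := by
    refine le_trans ?_ hck
    rw [blockNorm0, ← card_map Function.Embedding.inl]
    refine card_le_card fun i hi => ?_
    obtain ⟨j, hj, rfl⟩ := mem_map.1 hi
    simpa [hb] using hj
  rw [hsq, sum_smul_blockImages]
  exact (isLeast_blockRIC d Φ k).1.2 y hsp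

/-- The block null space property. -/
theorem eq_zero_of_mem_ker {M : ℕ} {Φ : Matrix (Fin M) (Fin (∑ i, d i)) ℝ} {s k : ℕ} (hs : 2 ≤ s)
    (hk : 2 ≤ k) (hks : k ≤ 2 * s) (hδk : blockRIC d Φ k * (4 * s - k) < k)
    (hδ2 : blockRIC d Φ k < 1 / 2) {x : EuclideanSpace ℝ (Fin (∑ i, d i))}
    (hx : Matrix.toEuclideanLin Φ x = 0) {S : Finset (Fin l)} (hS : #S ≤ s)
    (hle : ∑ i ∈ Sᶜ, ‖block d x i‖ ≤ ∑ i ∈ S, ‖block d x i‖) : x = 0 := by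
  have ha : ∀ i, 0 ≤ blockNorms d s x i := by rintro (i | i) <;> simp [blockNorms]
  -- The padding by `s` zeros provides a head of exactly `s` indices even when there are fewer than
  -- `s` blocks.
  obtain ⟨T, hTs, hT, hmax⟩ := exists_top_finset (blockNorms d s x) ha (s := s) (by simp)
  have hST : ∑ i ∈ S, ‖block d x i‖ ≤ ∑ i ∈ T, blockNorms d s x i := by
    have := hmax (S.map .inl) (by rwa [card_map])
    rwa [sum_map] at this
  have htot : ∑ i ∈ T, blockNorms d s x i + ∑ i ∈ Tᶜ, blockNorms d s x i =
      ∑ i ∈ S, ‖block d x i‖ + ∑ i ∈ Sᶜ, ‖block d x i‖ := by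
    rw [sum_add_sum_compl, sum_add_sum_compl, Fintype.sum_sum_type]
    simp [blockNorms]
  have hker : ∑ i, blockNorms d s x i • blockImages d Φ s x i = 0 := by
    rw [sum_smul_blockImages, scaleBlocks_eq_self, hx]
    exact fun i hi => mul_inv_cancel₀ hi
  have hzero := (isRIPOn_blockImages Φ s k x).head_eq_zero (isLeast_blockRIC d Φ k).1.1 ha hker
    (by rwa [hTs]) hT (by linarith) hk (by rwa [hTs]) (by rwa [hTs]) hδ2
  have hall : ∑ i, ‖block d x i‖ ≤ 0 := by
    rw [← sum_add_sum_compl S]; linarith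
  exact eq_zero_of_block_eq_zero fun i =>
    (sum_eq_zero_iff_of_nonneg fun i _ => norm_nonneg _).1
      (hall.antisymm (sum_nonneg fun i _ => norm_nonneg _)) i (mem_univ i)

/-- If `z` is at most as large as `x`, the part of `z - x` off the block support of `x` is
dominated by the part on it. -/
theorem sum_block_sub_le {x z : EuclideanSpace ℝ (Fin (∑ i, d i))}
    (h : blockNorm1 d z ≤ blockNorm1 d x) {S : Finset (Fin l)}
    (hS : ∀ i ∉ S, block d x i = 0) :
    ∑ i ∈ Sᶜ, ‖block d (z - x) i‖ ≤ ∑ i ∈ S, ‖block d (z - x) i‖ := by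
  rw [blockNorm1, blockNorm1, ← sum_add_sum_compl S, ← sum_add_sum_compl S] at h
  have h1 : ∑ i ∈ Sᶜ, ‖block d x i‖ = 0 :=
    sum_eq_zero fun i hi => by rw [hS i (mem_compl.1 hi), norm_zero]
  have h2 : ∑ i ∈ Sᶜ, ‖block d (z - x) i‖ = ∑ i ∈ Sᶜ, ‖block d z i‖ :=
    sum_congr rfl fun i hi => by rw [block_sub, hS i (mem_compl.1 hi), sub_zero]
  have h3 : ∑ i ∈ S, ‖block d x i‖ ≤
      ∑ i ∈ S, ‖block d z i‖ + ∑ i ∈ S, ‖block d (z - x) i‖ := by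
    rw [← sum_add_distrib]
    refine sum_le_sum fun i _ => ?_
    have := norm_sub_norm_le (block d x i) (block d z i)
    rw [block_sub, norm_sub_rev]
    linarith
  linarith

end BlockCS

end

/-! ### Passage from the real order `t s` to the integer `k`, and conclusion. -/

theorem corollary1p1 {l M : ℕ} (d : Fin l → ℕ) (hMN : M < ∑ i, d i)
    (Φ : Matrix (Fin M) (Fin (∑ i, d i)) ℝ) (s : ℕ) (t : ℝ) (ht0 : 0 < t) (ht : t < 4 / 3)
    (hts : 2 ≤ t * (s : ℝ)) (hδ : BlockCS.blockRIC d Φ ⌈t * (s : ℝ)⌉₊ < t / (4 - t))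
    (x : EuclideanSpace ℝ (Fin (∑ i, d i))) (hx : BlockCS.IsBlockSparse d s x)
    (b : EuclideanSpace ℝ (Fin M)) (hb : b = Matrix.toEuclideanLin Φ x) :
    BlockCS.l2l1Solutions d Φ b = {x} := by
  have hceil := Nat.le_ceil (t * (s : ℝ))
  have hceil' := Nat.ceil_lt_add_one (by linarith : 0 ≤ t * (s : ℝ))
  have hδ0 : 0 ≤ BlockCS.blockRIC d Φ ⌈t * (s : ℝ)⌉₊ := (BlockCS.isLeast_blockRIC d Φ _).1.1
  set k := ⌈t * (s : ℝ)⌉₊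
  set δ := BlockCS.blockRIC d Φ k
  have hk : 2 ≤ k := by exact_mod_cast hts.trans hceil
  have hs : 2 ≤ s := by
    have : (1 : ℝ) < s := by nlinarith [(Nat.cast_nonneg s : (0 : ℝ) ≤ s)]
    exact_mod_cast this
  have hs' : (2 : ℝ) ≤ s := by exact_mod_cast hs
  have hks : k ≤ 2 * s := by
    -- Indeed `k < t s + 1 < 4 s / 3 + 1 ≤ 2 s`, the last because `s ≥ 2`.
    have : (k : ℝ) < 2 * s := by nlinarith
    exact_mod_cast this.le
  rw [lt_div_iff₀ (by linarith)] at hδ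
  -- The function `t / (4 - t)` is increasing and equals `1 / 2` at `t = 4 / 3`.
  have hδ2 : δ < 1 / 2 := by nlinarith
  have hδk : δ * (4 * s - k) < k := by
    calc δ * (4 * s - k) ≤ δ * (4 * s - t * s) := by gcongr
      _ = δ * (4 - t) * s := by ring
      _ < t * s := by gcongr
      _ ≤ k := hceil
  have huniq : ∀ z, b = Matrix.toEuclideanLin Φ z →
      BlockCS.blockNorm1 d z ≤ BlockCS.blockNorm1 d x → z = x := by
    intro z hz hle
    refine sub_eq_zero.1 (BlockCS.eq_zero_of_mem_ker hs hk hks hδk hδ2 ?_ hx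
      (BlockCS.sum_block_sub_le hle fun i hi => ?_))
    · rw [map_sub, ← hz, ← hb, sub_self]
    · simpa using hi
  ext z
  refine ⟨fun hz => huniq z hz.1 (hz.2 x hb), ?_⟩
  rintro rfl
  refine ⟨hb, fun y hy => ?_⟩
  -- Minimality needs no separate argument: any feasible point that is no larger is `x` itself.
  rcases le_total (BlockCS.blockNorm1 d z) (BlockCS.blockNorm1 d y) with h | h
  · exact h
  · rw [huniq y hy h]
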